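/- Let $A\in\mathbb C^{n\times n}$ be Hermitian, and let the columns of $X,Y\in\mathbb C^{n\times p}$ form orthonormal bases of subspaces $\mathcal X,\mathcal Y\subseteq\mathbb C^n$, respectively (so $\dim\mathcal X=\dim\mathcal Y=p$). Let $P_{\mathcal X},P_{\mathcal Y}$ be the orthogonal projectors onto $\mathcal X,\mathcal Y$, and let $R_X=AX-X(X^HAX)$ and $R_Y=AY-Y(Y^HAY)$ be the residual matrices. For a Hermitian $p\times p$ matrix $M$ let $\Lambda(M)\in\mathbb R^p$ be the vector of its eigenvalues in decreasing order, counted with multiplicity, and for a matrix $M$ with $p$ columns and at least $p$ rows let $S(M)\in\mathbb R^p$ be the vector of its singular values in decreasing order. The principal angles between $\mathcal X$ and $\mathcal Y$ are the $p$ numbers in $[0,\pi/2]$ whose cosines are the singular values of $X^HY$; $\theta_{\max}(\mathcal X,\mathcal Y)$ denotes the largest of them. For $x,y\in\mathbb R^p$ write $x\prec_w y$ ($x$ is weakly majorized by $y$) if, for every $k=1,\dots,p$, the sum of the $k$ largest entries of $x$ is at most the sum of the $k$ largest entries of $y$. Absolute values, sums and differences of vectors are taken entrywise. Assume that all principal angles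 between $\mathcal X$ and $\mathcal Y$ are smaller than $\pi/2$. Then $$\left|\Lambda(X^HAX)-\Lambda(Y^HAY)\right|\prec_w\frac{1}{\cos\theta_{\max}(\mathcal X,\mathcal Y)}\left\{S(P_{\mathcal Y}R_X)+S(P_{\mathcal X}R_Y)\right\}.$$ If, in addition, $\mathcal X$ is $A$-invariant (that is, $A\mathcal X\subseteq\mathcal X$), then $$\left|\Lambda(X^HAX)-\Lambda(Y^HAY)\right|\prec_w\frac{1}{\cos\theta_{\max}(\mathcal X,\mathcal Y)}\,S(P_{\mathcal X}R_Y).$$ -/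

import Mathlib

open scoped Matrix

namespace RayleighRitz

noncomputable section

/-- The vector of eigenvalues, in decreasing order and repeated according to multiplicity, of a
Hermitian matrix. -/
def eigenvalueVec {p : ℕ} (M : Matrix (Fin p) (Fin p) ℂ) (hM : M.IsHermitian) : Fin p → ℝ :=
  (Matrix.isSymmetric_toEuclideanLin_iff.mpr hM).eigenvalues finrank_euclideanSpace_fin

/-- The vector of singular values, in decreasing order, of an `m × p` matrix. It has one entry per
column; for `p ≤ m` these are all the singular values, otherwise zeros are appended. -/
def singularValueVec {m p : ℕ} (M : Matrix (Fin m) (Fin p) ℂ) : Fin p → ℝ :=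
  fun i => (Matrix.toEuclideanLin M).singularValues i

/-- The rearrangement of a real vector in decreasing order. -/
def decreasing {p : ℕ} (x : Fin p → ℝ) : Fin p → ℝ :=
  x ∘ Tuple.sort (fun i => -x i)

theorem antitone_decreasing {p : ℕ} (x : Fin p → ℝ) : Antitone (decreasing x) := by
  intro i j hij
  have h := Tuple.monotone_sort (fun i => -x i) hij
  simp only [Function.comp_apply, neg_le_neg_iff] at h
  exact h

/-- Weak majorization of real vectors: for every `k`, the sum of the `k` largest entries of `x` is
at most the sum of the `k` largest entries of `y`. -/
def WeaklyMajorizedBy {p : ℕ} (x y : Fin p → ℝ) : Prop :=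
  ∀ k : Fin p, ∑ i ∈ Finset.Iic k, decreasing x i ≤ ∑ i ∈ Finset.Iic k, decreasing y i

/-- The columns of the matrix `X` form an orthonormal basis of the subspace `U` of `ℂⁿ`. -/
def ColumnsFormOrthonormalBasis {n p : ℕ} (X : Matrix (Fin n) (Fin p) ℂ)
    (U : Submodule ℂ (EuclideanSpace ℂ (Fin n))) : Prop :=
  Orthonormal ℂ (fun j : Fin p => WithLp.toLp 2 (X.col j)) ∧
    Submodule.span ℂ (Set.range fun j : Fin p => WithLp.toLp 2 (X.col j)) = U

/-- The matrix of the orthogonal projector of `ℂⁿ` onto the subspace `U`. -/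
def projectorMatrix {n : ℕ} (U : Submodule ℂ (EuclideanSpace ℂ (Fin n))) :
    Matrix (Fin n) (Fin n) ℂ :=
  Matrix.toEuclideanLin.symm U.starProjection.toLinearMap

/-- The residual matrix `R_X = A X - X (Xᴴ A X)`. -/
def residual {n p : ℕ} (A : Matrix (Fin n) (Fin n) ℂ) (X : Matrix (Fin n) (Fin p) ℂ) :
    Matrix (Fin n) (Fin p) ℂ :=
  A * X - X * (Xᴴ * A * X)

/-- The principal angles, in decreasing order, between two `p`-dimensional subspaces with
orthonormal bases given by the columns of `X` and of `Y`: the cosines of the angles are the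
singular values of `Xᴴ Y`, the smallest singular value corresponding to the largest angle. -/
def principalAngles {n p : ℕ} (X Y : Matrix (Fin n) (Fin p) ℂ) : Fin p → ℝ :=
  fun i => Real.arccos (singularValueVec (Xᴴ * Y) i.rev)

/-- The largest principal angle. -/
def maxAngle {n p : ℕ} (X Y : Matrix (Fin n) (Fin p) ℂ) : ℝ :=
  ⨆ i, principalAngles X Y i

end

end RayleighRitz

/-!
Write `H_X = Xᴴ A X`, `H_Y = Yᴴ A Y` and `C = Xᴴ Y`. The definition of the residuals and the symmetry
of `A` give `H_X C - C H_Y = Xᴴ R_Y - R_Xᴴ Y`. The singular values of `C` are at least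
`γ = cos θ_max > 0`, so `C = U T` with `U` unitary and `T ≥ γ` (`exists_polar_decomposition`).

The matrix `Uᴴ H_X U` has the eigenvalues of `H_X`. By the Lidskii–Wielandt inequality
(`exists_sum_abs_eigenvalues_sub_le`), a sum of `k` numbers `|λ_i(H_X) - λ_i(H_Y)|` is at most the
sum of `|μ_j|` over some `k` eigenvalues `μ_j` of the difference `D = Uᴴ H_X U - H_Y`. If `v` is a
unit vector with `D v = μ v`, then the real part of `⟪U v, (H_X C - C H_Y) v⟫` is `μ ⟪v, T v⟫`, and
hence
`γ |μ| ≤ |⟪X U v, R_Y v⟫| + |⟪R_X U v, Y v⟫|`.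
The projectors can be inserted in front of the residuals, and the sum over `k` orthonormal
eigenvectors `v` is bounded by the `k` largest singular values of `P_𝒳 R_Y` and `P_𝒴 R_X` by Ky Fan's
inequality (`sum_norm_inner_apply_le_sum_singularValues`). If `𝒳` is invariant, then `R_X = 0`.
-/

namespace RayleighRitz

open Module InnerProductSpace LinearMap

/-! ### Decreasing rearrangements -/

section Rearrangement

/-- The largest `k + 1` entries of a vector, as a set of indices `J`, together with the threshold
`τ` that separates them from the others. -/
theorem exists_card_eq_sum_eq_sum_decreasing {n : ℕ} (g : Fin n → ℝ) (k : Fin n) :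
    ∃ (J : Finset (Fin n)) (τ : ℝ), J.card = k + 1 ∧
      ∑ j ∈ J, g j = ∑ i ∈ Finset.Iic k, decreasing g i ∧ (∃ j ∈ J, g j = τ) ∧
      (∀ j ∈ J, τ ≤ g j) ∧ ∀ j ∉ J, g j ≤ τ := by
  set σ := Tuple.sort (fun i => -g i) with hσ
  have hd : ∀ i, decreasing g i = g (σ i) := fun i => rfl
  have hanti := antitone_decreasing g
  refine ⟨(Finset.Iic k).map σ.toEmbedding, decreasing g k, by simp, by simp [hd], ?_, ?_, ?_⟩
  · exact ⟨σ k, by simp, rfl⟩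
  · intro j hj
    simp only [Finset.mem_map_equiv, Finset.mem_Iic] at hj
    simpa [hd] using hanti hj
  · intro j hj
    simp only [Finset.mem_map_equiv, Finset.mem_Iic, not_le] at hj
    simpa [hd] using hanti hj.le

theorem decreasing_eq_self {n : ℕ} {g : Fin n → ℝ} (hg : Antitone g) : decreasing g = g := by
  have : Tuple.sort (fun i => -g i) = Equiv.refl _ :=
    Tuple.sort_eq_refl_iff_monotone.mpr fun i j hij => neg_le_neg (hg hij)
  simp [decreasing, this]

end Rearrangement

section Operators

variable {𝕜 E F : Type*} [RCLike 𝕜] [NormedAddCommGroup E] [InnerProductSpace 𝕜 E]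
  [NormedAddCommGroup F] [InnerProductSpace 𝕜 F]

/-! ### Operators that are diagonal in an orthonormal basis -/

section Diagonal

variable {ι : Type*} [Fintype ι]

/-- The quadratic form of an operator with an orthonormal basis of eigenvectors. -/
theorem re_inner_apply_self_eq_sum {T : E →ₗ[𝕜] E} {b : OrthonormalBasis ι 𝕜 E} {c : ι → ℝ}
    (hT : ∀ i, T (b i) = (c i : 𝕜) • b i) (x : E) :
    RCLike.re ⟪x, T x⟫_𝕜 = ∑ i, c i * ‖⟪b i, x⟫_𝕜‖ ^ 2 := by
  have h : T x = ∑ i, ⟪b i, x⟫_𝕜 • (c i : 𝕜) • b i := by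
    conv_lhs => rw [← b.sum_repr' x, map_sum]
    simp only [map_smul, hT]
  rw [h, inner_sum, map_sum]
  refine Finset.sum_congr rfl fun i _ => ?_
  rw [inner_smul_right, inner_smul_right, ← inner_conj_symm x, mul_left_comm, RCLike.mul_conj]
  norm_cast

/-- The operator with eigenvectors the members of the orthonormal basis `b` and eigenvalues `c`. -/
noncomputable def diagonalOperator (b : OrthonormalBasis ι 𝕜 E) (c : ι → ℝ) : E →ₗ[𝕜] E :=
  b.toBasis.constr 𝕜 fun i => (c i : 𝕜) • b i

@[simp] theorem diagonalOperator_apply_basis (b : OrthonormalBasis ι 𝕜 E) (c : ι → ℝ) (i : ι) :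
    diagonalOperator b c (b i) = (c i : 𝕜) • b i := by
  have := b.toBasis.constr_basis 𝕜 (fun i => (c i : 𝕜) • b i) i
  simpa [diagonalOperator] using this

theorem isSymmetric_diagonalOperator (b : OrthonormalBasis ι 𝕜 E) (c : ι → ℝ) :
    (diagonalOperator b c).IsSymmetric := by
  have h : ∀ x, diagonalOperator b c x = ∑ i, ⟪b i, x⟫_𝕜 • (c i : 𝕜) • b i := fun x => by
    conv_lhs => rw [← b.sum_repr' x, map_sum]
    simp only [map_smul, diagonalOperator_apply_basis]
  intro x y
  rw [h, h, sum_inner, inner_sum]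
  refine Finset.sum_congr rfl fun i _ => ?_
  simp only [inner_smul_left, inner_smul_right, inner_conj_symm, RCLike.conj_ofReal]
  ring

theorem trace_diagonalOperator (b : OrthonormalBasis ι 𝕜 E) (c : ι → ℝ) :
    LinearMap.trace 𝕜 E (diagonalOperator b c) = ((∑ i, c i : ℝ) : 𝕜) := by
  rw [LinearMap.trace_eq_sum_inner _ b]
  simp [inner_smul_right]

end Diagonal

variable [FiniteDimensional 𝕜 E] {n : ℕ}

/-! ### Perturbation of eigenvalues -/

section Eigenvalues

/-- Weyl's monotonicity principle with a shift. If the `i`-th eigenvalues violated the inequality,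
then a nonzero vector that is orthogonal to the last eigenvectors of `A` and to the first ones of
`B` would violate the hypothesis. -/
theorem eigenvalues_le_eigenvalues_add {A B : E →ₗ[𝕜] E} (hA : A.IsSymmetric) (hB : B.IsSymmetric)
    (hn : finrank 𝕜 E = n) {τ : ℝ}
    (h : ∀ x, RCLike.re ⟪x, A x⟫_𝕜 ≤ RCLike.re ⟪x, B x⟫_𝕜 + τ * ‖x‖ ^ 2) (i : Fin n) :
    hA.eigenvalues hn i ≤ hB.eigenvalues hn i + τ := by
  set a := hA.eigenvectorBasis hn
  set b := hB.eigenvectorBasis hn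
  let L : E →ₗ[𝕜] ({j : Fin n // j ≠ i} → 𝕜) :=
    LinearMap.pi fun j => if i < j.1 then innerₛₗ 𝕜 (a j.1) else innerₛₗ 𝕜 (b j.1)
  have hL : LinearMap.ker L ≠ ⊥ := by
    apply LinearMap.ker_ne_bot_of_finrank_lt
    have := i.pos
    simp [hn, Fintype.card_subtype_compl]
    omega
  obtain ⟨x, hx, hx0⟩ := Submodule.exists_mem_ne_zero_of_ne_bot hL
  have hxj : ∀ j : {j : Fin n // j ≠ i}, L x j = 0 := fun j => by
    rw [LinearMap.mem_ker.mp hx]; rfl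
  have ha : ∀ j, i < j → ⟪a j, x⟫_𝕜 = 0 := fun j hj => by
    simpa [L, hj] using hxj ⟨j, hj.ne'⟩
  have hb : ∀ j, j < i → ⟪b j, x⟫_𝕜 = 0 := fun j hj => by
    simpa [L, hj.not_gt] using hxj ⟨j, hj.ne⟩
  have h1 : hA.eigenvalues hn i * ‖x‖ ^ 2 ≤ RCLike.re ⟪x, A x⟫_𝕜 := by
    rw [re_inner_apply_self_eq_sum (hA.apply_eigenvectorBasis hn), ← a.sum_sq_norm_inner_right x,
      Finset.mul_sum]
    refine Finset.sum_le_sum fun j _ => ?_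
    rcases le_or_gt j i with hj | hj
    · exact mul_le_mul_of_nonneg_right (hA.eigenvalues_antitone hn hj) (by positivity)
    · simp [a, ha j hj]
  have h2 : RCLike.re ⟪x, B x⟫_𝕜 ≤ hB.eigenvalues hn i * ‖x‖ ^ 2 := by
    rw [re_inner_apply_self_eq_sum (hB.apply_eigenvectorBasis hn), ← b.sum_sq_norm_inner_right x,
      Finset.mul_sum]
    refine Finset.sum_le_sum fun j _ => ?_
    rcases le_or_gt i j with hj | hj
    · exact mul_le_mul_of_nonneg_right (hB.eigenvalues_antitone hn hj) (by positivity)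
    · simp [b, hb j hj]
  have hpos : 0 < ‖x‖ ^ 2 := by positivity
  refine le_of_mul_le_mul_right ?_ hpos
  linarith [h x]

/-- The Lidskii–Wielandt inequality for absolute values: differences of the ordered eigenvalues of
`A` and `B` are dominated by absolute values of eigenvalues of `A - B`. With `τ` the smallest of
the `k + 1` largest absolute values, `A` lies between `B - τ - N` and `B + τ + P`, where `P` and
`N` are the parts of `±(A - B)` that exceed `τ`; the eigenvalue shifts caused by `P` and `N` are
nonnegative and add up to the traces of `P` and `N`. -/
theorem exists_sum_abs_eigenvalues_sub_le {A B D : E →ₗ[𝕜] E} (hA : A.IsSymmetric)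
    (hB : B.IsSymmetric) (hD : D.IsSymmetric) (hABD : ∀ x, A x = B x + D x)
    (hn : finrank 𝕜 E = n) (k : Fin n) (I : Finset (Fin n)) (hI : I.card = k + 1) :
    ∃ J : Finset (Fin n), J.card = k + 1 ∧
      ∑ i ∈ I, |hA.eigenvalues hn i - hB.eigenvalues hn i| ≤ ∑ j ∈ J, |hD.eigenvalues hn j| := by
  set μ := hD.eigenvalues hn
  set v := hD.eigenvectorBasis hn
  obtain ⟨J, τ, hJ, -, ⟨j₀, -, hj₀⟩, hJle, hJge⟩ :=
    exists_card_eq_sum_eq_sum_decreasing (fun i => |μ i|) k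
  refine ⟨J, hJ, ?_⟩
  have hτ : 0 ≤ τ := hj₀ ▸ abs_nonneg _
  set P := diagonalOperator v fun i => max (μ i - τ) 0
  set N := diagonalOperator v fun i => max (-μ i - τ) 0
  have hP : P.IsSymmetric := isSymmetric_diagonalOperator _ _
  have hN : N.IsSymmetric := isSymmetric_diagonalOperator _ _
  have hBP : (B + P).IsSymmetric := hB.add hP
  have hBN : (B - N).IsSymmetric := hB.sub hN
  have hPq : ∀ x, RCLike.re ⟪x, P x⟫_𝕜 = ∑ i, max (μ i - τ) 0 * ‖⟪v i, x⟫_𝕜‖ ^ 2 :=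
    re_inner_apply_self_eq_sum (diagonalOperator_apply_basis v _)
  have hNq : ∀ x, RCLike.re ⟪x, N x⟫_𝕜 = ∑ i, max (-μ i - τ) 0 * ‖⟪v i, x⟫_𝕜‖ ^ 2 :=
    re_inner_apply_self_eq_sum (diagonalOperator_apply_basis v _)
  have hDq : ∀ x, RCLike.re ⟪x, D x⟫_𝕜 = ∑ i, μ i * ‖⟪v i, x⟫_𝕜‖ ^ 2 :=
    re_inner_apply_self_eq_sum (hD.apply_eigenvectorBasis hn)
  have hP0 : ∀ x, 0 ≤ RCLike.re ⟪x, P x⟫_𝕜 := fun x => by rw [hPq]; positivity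
  have hN0 : ∀ x, 0 ≤ RCLike.re ⟪x, N x⟫_𝕜 := fun x => by rw [hNq]; positivity
  have hDP : ∀ x, RCLike.re ⟪x, D x⟫_𝕜 ≤ RCLike.re ⟪x, P x⟫_𝕜 + τ * ‖x‖ ^ 2 := fun x => by
    rw [hDq, hPq, ← v.sum_sq_norm_inner_right x, Finset.mul_sum, ← Finset.sum_add_distrib]
    refine Finset.sum_le_sum fun i _ => ?_
    rw [← add_mul]
    exact mul_le_mul_of_nonneg_right (by linarith [le_max_left (μ i - τ) 0]) (by positivity)
  have hDN : ∀ x, 0 ≤ RCLike.re ⟪x, D x⟫_𝕜 + RCLike.re ⟪x, N x⟫_𝕜 + τ * ‖x‖ ^ 2 := fun x => by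
    rw [hDq, hNq, ← v.sum_sq_norm_inner_right x, Finset.mul_sum, ← Finset.sum_add_distrib,
      ← Finset.sum_add_distrib]
    refine Finset.sum_nonneg fun i _ => ?_
    rw [← add_mul, ← add_mul]
    exact mul_nonneg (by linarith [le_max_left (-μ i - τ) 0]) (by positivity)
  have e1 : ∀ i, hA.eigenvalues hn i ≤ hBP.eigenvalues hn i + τ :=
    eigenvalues_le_eigenvalues_add hA hBP hn fun x => by
      simp only [hABD, LinearMap.add_apply, inner_add_right, map_add]
      linarith [hDP x]
  have e2 : ∀ i, hBN.eigenvalues hn i ≤ hA.eigenvalues hn i + τ :=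
    eigenvalues_le_eigenvalues_add hBN hA hn fun x => by
      simp only [hABD, LinearMap.sub_apply, inner_add_right, inner_sub_right, map_add, map_sub]
      linarith [hDN x]
  have e3 : ∀ i, hB.eigenvalues hn i ≤ hBP.eigenvalues hn i + 0 :=
    eigenvalues_le_eigenvalues_add hB hBP hn fun x => by
      simp only [LinearMap.add_apply, inner_add_right, map_add]
      linarith [hP0 x]
  have e4 : ∀ i, hBN.eigenvalues hn i ≤ hB.eigenvalues hn i + 0 :=
    eigenvalues_le_eigenvalues_add hBN hB hn fun x => by
      simp only [LinearMap.sub_apply, inner_sub_right, map_sub]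
      linarith [hN0 x]
  have tP : ∑ i, hBP.eigenvalues hn i = ∑ i, hB.eigenvalues hn i + ∑ i, max (μ i - τ) 0 := by
    have h := hBP.trace_eq_sum_eigenvalues hn
    rw [map_add, hB.trace_eq_sum_eigenvalues hn, trace_diagonalOperator] at h
    exact_mod_cast h.symm
  have tN : ∑ i, hBN.eigenvalues hn i = ∑ i, hB.eigenvalues hn i - ∑ i, max (-μ i - τ) 0 := by
    have h := hBN.trace_eq_sum_eigenvalues hn
    rw [map_sub, hB.trace_eq_sum_eigenvalues hn, trace_diagonalOperator] at h
    exact_mod_cast h.symm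
  have hJsum : ∑ i, (max (μ i - τ) 0 + max (-μ i - τ) 0) = ∑ j ∈ J, (|μ j| - τ) := by
    have hval : ∀ i, max (μ i - τ) 0 + max (-μ i - τ) 0 = max (|μ i| - τ) 0 := fun i => by
      rcases le_total 0 (μ i) with h | h
      · rw [abs_of_nonneg h, max_eq_right (a := -μ i - τ) (by linarith), add_zero]
      · rw [abs_of_nonpos h, max_eq_right (a := μ i - τ) (by linarith), zero_add]
    rw [← Finset.sum_subset (Finset.subset_univ J)]
    · refine Finset.sum_congr rfl fun j hj => ?_
      rw [hval, max_eq_left (by linarith [hJle j hj])]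
    · intro j _ hj
      rw [hval, max_eq_right (by linarith [hJge j hj])]
  calc ∑ i ∈ I, |hA.eigenvalues hn i - hB.eigenvalues hn i|
      ≤ ∑ i ∈ I, (τ + (hBP.eigenvalues hn i - hBN.eigenvalues hn i)) := by
        refine Finset.sum_le_sum fun i _ => abs_le.mpr ⟨?_, ?_⟩ <;>
          linarith [e1 i, e2 i, e3 i, e4 i]
    _ = (k + 1) * τ + ∑ i ∈ I, (hBP.eigenvalues hn i - hBN.eigenvalues hn i) := by
        rw [Finset.sum_add_distrib, Finset.sum_const, hI]; simp
    _ ≤ (k + 1) * τ + ∑ i, (hBP.eigenvalues hn i - hBN.eigenvalues hn i) := by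
        refine add_le_add_right (Finset.sum_le_sum_of_subset_of_nonneg (Finset.subset_univ I)
          fun i _ _ => sub_nonneg.mpr ?_) _
        linarith [e3 i, e4 i]
    _ = (k + 1) * τ + ∑ j ∈ J, (|μ j| - τ) := by
        rw [← hJsum, Finset.sum_sub_distrib, tP, tN, Finset.sum_add_distrib]; ring
    _ = ∑ j ∈ J, |μ j| := by
        rw [Finset.sum_sub_distrib, Finset.sum_const, hJ]; simp

end Eigenvalues

/-! ### Singular values and polar decomposition -/

section SingularValues

/-- The vectors `T (e i)`, with `e` the eigenvector basis of `T† T`, are orthogonal and have the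
singular values of `T` as their norms. -/
theorem inner_apply_eigenvectorBasis [FiniteDimensional 𝕜 F] (T : E →ₗ[𝕜] F)
    (hn : finrank 𝕜 E = n) (i j : Fin n) :
    ⟪T (T.isSymmetric_adjoint_comp_self.eigenvectorBasis hn i),
      T (T.isSymmetric_adjoint_comp_self.eigenvectorBasis hn j)⟫_𝕜 =
      if i = j then ((T.singularValues i : 𝕜)) ^ 2 else 0 := by
  have h := T.isSymmetric_adjoint_comp_self.apply_eigenvectorBasis hn j
  rw [← LinearMap.adjoint_inner_right, ← LinearMap.comp_apply, h, inner_smul_right,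
    orthonormal_iff_ite.mp (OrthonormalBasis.orthonormal _), ← T.sq_singularValues_fin hn]
  split_ifs with hij <;> simp [hij]

/-- Ky Fan's inequality: in an expansion of `T` along its singular vectors, the coefficient of each
singular value is at most `1` and the coefficients add up to at most `k + 1`, by Bessel's
inequality. -/
theorem sum_norm_inner_apply_le_sum_singularValues [FiniteDimensional 𝕜 F] (T : E →ₗ[𝕜] F)
    (hn : finrank 𝕜 E = n) (k : Fin n) {ι : Type*} (J : Finset ι) (hJ : J.card = k + 1)
    {u : ι → F} {w : ι → E} (hu : Orthonormal 𝕜 u) (hw : Orthonormal 𝕜 w) :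
    ∑ j ∈ J, ‖⟪u j, T (w j)⟫_𝕜‖ ≤ ∑ i ∈ Finset.Iic k, T.singularValues i := by
  set e := T.isSymmetric_adjoint_comp_self.eigenvectorBasis hn
  set s : Fin n → ℝ := fun i => T.singularValues i with hs
  have hs0 : ∀ i, 0 ≤ s i := fun i => T.singularValues_nonneg i
  have hanti : Antitone s := fun i j hij => T.singularValues_antitone hij
  -- The left singular vectors; they are zero, not unit vectors, where the singular value vanishes.
  set f : Fin n → F := fun i => ((s i : 𝕜))⁻¹ • T (e i) with hf
  have hff : ∀ i j, ⟪f i, f j⟫_𝕜 = if i = j ∧ s i ≠ 0 then 1 else 0 := fun i j => by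
    simp only [hf, inner_smul_left, inner_smul_right]
    rw [inner_apply_eigenvectorBasis T hn]
    by_cases hij : i = j
    · subst hij
      by_cases h0 : s i = 0
      · simp [h0]
      · have h0' : (s i : 𝕜) ≠ 0 := by exact_mod_cast h0
        simp only [if_true, h0, ne_eq, not_false_eq_true, and_self, map_inv₀, RCLike.conj_ofReal]
        change (s i : 𝕜)⁻¹ * ((s i : 𝕜)⁻¹ * (s i : 𝕜) ^ 2) = 1
        field_simp
    · simp [hij]
  have hTe : ∀ i, T (e i) = (s i : 𝕜) • f i := fun i => by
    by_cases h0 : s i = 0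
    · have : ⟪T (e i), T (e i)⟫_𝕜 = 0 := by
        rw [inner_apply_eigenvectorBasis T hn]
        have h0' : T.singularValues i = 0 := h0
        simp [h0']
      rw [inner_self_eq_zero.mp this, h0]; simp
    · have h0' : (s i : 𝕜) ≠ 0 := by exact_mod_cast h0
      rw [hf, smul_inv_smul₀ h0']
  have hfnorm : ∀ i, ‖f i‖ ^ 2 ≤ 1 := fun i => by
    rw [← inner_self_eq_norm_sq (𝕜 := 𝕜), hff]
    split_ifs <;> simp
  have hfBessel : ∀ y, ∑ i, ‖⟪f i, y⟫_𝕜‖ ^ 2 ≤ ‖y‖ ^ 2 := fun y => by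
    have ho : Orthonormal 𝕜 fun i : {i // s i ≠ 0} => f i := by
      classical
      rw [orthonormal_iff_ite]
      intro i j
      rw [hff]
      simp [Subtype.ext_iff, i.2]
    refine le_trans (le_of_eq ?_) (ho.sum_inner_products_le y (s := Finset.univ))
    rw [← Finset.sum_filter_of_ne (p := fun i => s i ≠ 0),
      Finset.sum_subtype (p := fun i => s i ≠ 0) _ (by simp)]
    intro i _ h h0
    exact h (by simp [hf, h0])
  set c : Fin n → ℝ := fun i => ∑ j ∈ J, ‖⟪u j, f i⟫_𝕜‖ * ‖⟪e i, w j⟫_𝕜‖ with hc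
  have hAMGM : ∀ a b : ℝ, a * b ≤ (a ^ 2 + b ^ 2) / 2 := fun a b => by nlinarith [sq_nonneg (a - b)]
  have hc1 : ∀ i, c i ≤ 1 := fun i => by
    calc c i ≤ ∑ j ∈ J, (‖⟪u j, f i⟫_𝕜‖ ^ 2 + ‖⟪w j, e i⟫_𝕜‖ ^ 2) / 2 :=
          Finset.sum_le_sum fun j _ => by rw [norm_inner_symm (w j)]; exact hAMGM _ _
      _ = (∑ j ∈ J, ‖⟪u j, f i⟫_𝕜‖ ^ 2 + ∑ j ∈ J, ‖⟪w j, e i⟫_𝕜‖ ^ 2) / 2 := by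
          rw [← Finset.sum_div, Finset.sum_add_distrib]
      _ ≤ 1 := by
          have h1 := hu.sum_inner_products_le (f i) (s := J)
          have h2 := hw.sum_inner_products_le (e i) (s := J)
          have h3 : ‖e i‖ = 1 := e.orthonormal.1 i
          rw [h3] at h2
          linarith [hfnorm i]
  have hcsum : ∑ i, c i ≤ k + 1 := by
    rw [hc, Finset.sum_comm]
    calc _ ≤ ∑ j ∈ J, (1 : ℝ) := Finset.sum_le_sum fun j _ => ?_
      _ = k + 1 := by simp [hJ]
    calc _ ≤ ∑ i, (‖⟪f i, u j⟫_𝕜‖ ^ 2 + ‖⟪e i, w j⟫_𝕜‖ ^ 2) / 2 :=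
          Finset.sum_le_sum fun i _ => by rw [norm_inner_symm (f i)]; exact hAMGM _ _
      _ = (∑ i, ‖⟪f i, u j⟫_𝕜‖ ^ 2 + ∑ i, ‖⟪e i, w j⟫_𝕜‖ ^ 2) / 2 := by
          rw [← Finset.sum_div, Finset.sum_add_distrib]
      _ ≤ 1 := by
          have h1 := hfBessel (u j)
          rw [e.sum_sq_norm_inner_right, hw.1 j]
          rw [hu.1 j] at h1
          linarith
  have hexp : ∀ j, ‖⟪u j, T (w j)⟫_𝕜‖ ≤ ∑ i, s i * (‖⟪u j, f i⟫_𝕜‖ * ‖⟪e i, w j⟫_𝕜‖) := fun j => by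
    conv_lhs => rw [← e.sum_repr' (w j), map_sum, inner_sum]
    refine (norm_sum_le _ _).trans (le_of_eq (Finset.sum_congr rfl fun i _ => ?_))
    rw [map_smul, hTe, inner_smul_right, inner_smul_right, norm_mul, norm_mul, RCLike.norm_ofReal,
      abs_of_nonneg (hs0 i)]
    ring
  calc ∑ j ∈ J, ‖⟪u j, T (w j)⟫_𝕜‖ ≤ ∑ i, s i * c i := by
        refine (Finset.sum_le_sum fun j _ => hexp j).trans (le_of_eq ?_)
        rw [Finset.sum_comm]
        simp [hc, Finset.mul_sum]
    _ ≤ ∑ i, (s k * c i + if i ≤ k then s i - s k else 0) := by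
        -- Only the excess over the threshold `s k` is estimated by `c i ≤ 1`.
        refine Finset.sum_le_sum fun i _ => ?_
        have hc0 : 0 ≤ c i := by positivity
        split_ifs with hik
        · nlinarith [hanti hik, hc1 i]
        · nlinarith [hanti (not_le.mp hik).le]
    _ = s k * ∑ i, c i + ∑ i ∈ Finset.Iic k, (s i - s k) := by
        rw [Finset.sum_add_distrib, Finset.mul_sum, ← Finset.sum_filter]
        congr 2
        ext; simp
    _ ≤ s k * (k + 1) + ∑ i ∈ Finset.Iic k, (s i - s k) := by
        gcongr
        exact hs0 k
    _ = ∑ i ∈ Finset.Iic k, T.singularValues i := by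
        rw [Finset.sum_sub_distrib, Finset.sum_const]; simp [hs]; ring

/-- The polar decomposition of an operator all of whose singular values are at least `γ > 0`. -/
theorem exists_polar_decomposition (C : E →ₗ[𝕜] E) (hn : finrank 𝕜 E = n) {γ : ℝ} (hγ : 0 < γ)
    (hC : ∀ i : Fin n, γ ≤ C.singularValues i) :
    ∃ (U : E ≃ₗᵢ[𝕜] E) (T : E →ₗ[𝕜] E), T.IsSymmetric ∧
      (∀ x, γ * ‖x‖ ^ 2 ≤ RCLike.re ⟪x, T x⟫_𝕜) ∧ ∀ x, C x = U (T x) := by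
  set e := C.isSymmetric_adjoint_comp_self.eigenvectorBasis hn
  set s : Fin n → ℝ := fun i => C.singularValues i with hs
  have hs0 : ∀ i, (s i : 𝕜) ≠ 0 := fun i => by exact_mod_cast (hγ.trans_le (hC i)).ne'
  have hf : Orthonormal 𝕜 fun i => ((s i : 𝕜))⁻¹ • C (e i) := by
    rw [orthonormal_iff_ite]
    intro i j
    rw [inner_smul_left, inner_smul_right, inner_apply_eigenvectorBasis C hn]
    split_ifs with hij
    · subst hij
      have h0 := hs0 i
      rw [map_inv₀, RCLike.conj_ofReal]
      change (s i : 𝕜)⁻¹ * ((s i : 𝕜)⁻¹ * (s i : 𝕜) ^ 2) = 1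
      field_simp
    · simp
  have hsp : ⊤ ≤ Submodule.span 𝕜 (Set.range fun i => ((s i : 𝕜))⁻¹ • C (e i)) :=
    (hf.linearIndependent.span_eq_top_of_card_eq_finrank' (by simp [hn])).ge
  set f := OrthonormalBasis.mk hf hsp
  refine ⟨e.equiv f (Equiv.refl _), diagonalOperator e s, isSymmetric_diagonalOperator _ _, ?_, ?_⟩
  · intro x
    rw [re_inner_apply_self_eq_sum (diagonalOperator_apply_basis e s),
      ← e.sum_sq_norm_inner_right x, Finset.mul_sum]
    exact Finset.sum_le_sum fun i _ => mul_le_mul_of_nonneg_right (hC i) (by positivity)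
  · intro x
    have : C = (e.equiv f (Equiv.refl _)).toLinearEquiv.toLinearMap ∘ₗ diagonalOperator e s := by
      refine e.toBasis.ext fun i => ?_
      simp [f, smul_smul, hs0 i]
    exact LinearMap.congr_fun this x

end SingularValues

end Operators

/-! ### Ritz values of a symmetric operator -/

section RitzValues

variable {𝕜 E F : Type*} [RCLike 𝕜] [NormedAddCommGroup E] [InnerProductSpace 𝕜 E]
  [NormedAddCommGroup F] [InnerProductSpace 𝕜 F] [FiniteDimensional 𝕜 E] [FiniteDimensional 𝕜 F]
  {p : ℕ}

/-- The comparison of Ritz values in terms of operators. Here `HX` and `HY` are the compressions of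
the symmetric operator `A` along the isometries `X` and `Y`, with residuals `RX` and `RY`, and `PX`
and `PY` behave like orthogonal projectors onto the ranges of `X` and `Y`. -/
theorem mul_sum_abs_eigenvalues_sub_le {A : F →ₗ[𝕜] F} (hA : A.IsSymmetric) (X Y : E →ₗᵢ[𝕜] F)
    {HX HY : E →ₗ[𝕜] E} (hHX : HX.IsSymmetric) (hHY : HY.IsSymmetric) {RX RY : E →ₗ[𝕜] F}
    (hRX : ∀ x, A (X x) = X (HX x) + RX x) (hRY : ∀ x, A (Y x) = Y (HY x) + RY x)
    {PX PY : F →ₗ[𝕜] F} (hPX : ∀ x y, ⟪X x, PX y⟫_𝕜 = ⟪X x, y⟫_𝕜)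
    (hPY : ∀ x y, ⟪Y x, PY y⟫_𝕜 = ⟪Y x, y⟫_𝕜) {C : E →ₗ[𝕜] E}
    (hC : ∀ x y, ⟪x, C y⟫_𝕜 = ⟪X x, Y y⟫_𝕜) (hp : finrank 𝕜 E = p) {γ : ℝ} (hγ : 0 < γ)
    (hγC : ∀ i : Fin p, γ ≤ C.singularValues i) (k : Fin p) (I : Finset (Fin p))
    (hI : I.card = k + 1) :
    γ * ∑ i ∈ I, |hHX.eigenvalues hp i - hHY.eigenvalues hp i| ≤
      ∑ i ∈ Finset.Iic k, ((PY ∘ₗ RX).singularValues i + (PX ∘ₗ RY).singularValues i) := by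
  obtain ⟨U, T, hT, hTγ, hCUT⟩ := exists_polar_decomposition C hp hγ hγC
  -- The operator `U† HX U` has the eigenvalues of `HX` and is compared with `HY`.
  set HU : E →ₗ[𝕜] E := U.symm.toLinearEquiv.conj HX with hHU
  have hHUx : ∀ x, HU x = U.symm (HX (U x)) := fun x => rfl
  have hHUs : HU.IsSymmetric := fun x y => by
    rw [hHUx, hHUx, ← U.inner_map_map, ← U.inner_map_map x, U.apply_symm_apply,
      U.apply_symm_apply, hHX]
  have heig : hHX.eigenvalues hp = hHUs.eigenvalues hp := by
    rw [hHX.eigenvalues_eq_eigenvalues_iff, hHU, LinearEquiv.charpoly_conj]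
  have hD : (HU - HY).IsSymmetric := hHUs.sub hHY
  obtain ⟨J, hJ, hIJ⟩ := exists_sum_abs_eigenvalues_sub_le hHUs hHY hD (fun x => by simp) hp k I hI
  set v := hD.eigenvectorBasis hp
  set μ := hD.eigenvalues hp
  -- The commutator-like operator `HX C - C HY` is expressed by the residuals.
  have hres : ∀ x y, ⟪HX x, C y⟫_𝕜 - ⟪x, C (HY y)⟫_𝕜 = ⟪X x, RY y⟫_𝕜 - ⟪RX x, Y y⟫_𝕜 :=
    fun x y => by
      have h := hA (X x) (Y y)
      rw [hRX, hRY, inner_add_left, inner_add_right] at h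
      rw [hC, hC]
      linear_combination h
  have key : ∀ j, γ * |μ j| ≤
      ‖⟪Y (v j), (PY ∘ₗ RX) (U (v j))⟫_𝕜‖ + ‖⟪X (U (v j)), (PX ∘ₗ RY) (v j)⟫_𝕜‖ := fun j => by
    have hμ : HU (v j) = HY (v j) + (μ j : 𝕜) • v j := by
      have h := hD.apply_eigenvectorBasis hp j
      rw [LinearMap.sub_apply, sub_eq_iff_eq_add'] at h
      exact h
    have h1 : ⟪HX (U (v j)), C (v j)⟫_𝕜 = ⟪HU (v j), T (v j)⟫_𝕜 := by
      rw [hCUT, hHUx, ← U.inner_map_map (U.symm _), U.apply_symm_apply]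
    have h2 : ⟪U (v j), C (HY (v j))⟫_𝕜 = ⟪T (v j), HY (v j)⟫_𝕜 := by
      rw [hCUT, U.inner_map_map, hT]
    -- The remaining parts of the two inner products have equal real parts.
    have h3 : RCLike.re (⟪X (U (v j)), RY (v j)⟫_𝕜 - ⟪RX (U (v j)), Y (v j)⟫_𝕜) =
        μ j * RCLike.re ⟪v j, T (v j)⟫_𝕜 := by
      rw [← hres, h1, h2, hμ, inner_add_left, inner_smul_left, RCLike.conj_ofReal, map_sub,
        map_add, RCLike.re_ofReal_mul, inner_re_symm (T (v j))]
      ring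
    have h4 : γ ≤ RCLike.re ⟪v j, T (v j)⟫_𝕜 := by
      have := hTγ (v j)
      rwa [v.orthonormal.1 j, one_pow, mul_one] at this
    calc γ * |μ j| ≤ RCLike.re ⟪v j, T (v j)⟫_𝕜 * |μ j| := by gcongr
      _ = |μ j * RCLike.re ⟪v j, T (v j)⟫_𝕜| := by
        rw [abs_mul, abs_of_nonneg (hγ.le.trans h4), mul_comm]
      _ ≤ ‖⟪X (U (v j)), RY (v j)⟫_𝕜 - ⟪RX (U (v j)), Y (v j)⟫_𝕜‖ := h3 ▸ RCLike.abs_re_le_norm _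
      _ ≤ ‖⟪X (U (v j)), RY (v j)⟫_𝕜‖ + ‖⟪RX (U (v j)), Y (v j)⟫_𝕜‖ := norm_sub_le _ _
      _ = _ := by
        rw [LinearMap.comp_apply, LinearMap.comp_apply, hPX, hPY,
          norm_inner_symm (RX (U (v j))), add_comm]
  have hUv : Orthonormal 𝕜 fun j => U (v j) := v.orthonormal.comp_linearIsometryEquiv U
  have hXUv : Orthonormal 𝕜 fun j => X (U (v j)) := hUv.comp_linearIsometry X
  have hYv : Orthonormal 𝕜 fun j => Y (v j) := v.orthonormal.comp_linearIsometry Y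
  calc γ * ∑ i ∈ I, |hHX.eigenvalues hp i - hHY.eigenvalues hp i|
      ≤ γ * ∑ j ∈ J, |μ j| := by rw [heig]; gcongr
    _ ≤ ∑ j ∈ J, ‖⟪Y (v j), (PY ∘ₗ RX) (U (v j))⟫_𝕜‖ +
          ∑ j ∈ J, ‖⟪X (U (v j)), (PX ∘ₗ RY) (v j)⟫_𝕜‖ := by
        rw [Finset.mul_sum, ← Finset.sum_add_distrib]
        exact Finset.sum_le_sum fun j _ => key j
    _ ≤ _ := by
        rw [Finset.sum_add_distrib]
        exact add_le_add (sum_norm_inner_apply_le_sum_singularValues _ hp k J hJ hYv hUv)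
          (sum_norm_inner_apply_le_sum_singularValues _ hp k J hJ hXUv v.orthonormal)

end RitzValues

/-! ### Matrices with orthonormal columns, residuals and principal angles -/

section Matrices

variable {m n p : ℕ}

theorem toEuclideanLin_mul_apply (M : Matrix (Fin m) (Fin n) ℂ) (N : Matrix (Fin n) (Fin p) ℂ)
    (x : EuclideanSpace ℂ (Fin p)) :
    (M * N).toEuclideanLin x = M.toEuclideanLin (N.toEuclideanLin x) := by
  simp [Matrix.toLpLin_apply]

theorem inner_toEuclideanLin_conjTranspose (M : Matrix (Fin n) (Fin p) ℂ)
    (x : EuclideanSpace ℂ (Fin p)) (y : EuclideanSpace ℂ (Fin n)) :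
    ⟪x, Mᴴ.toEuclideanLin y⟫_ℂ = ⟪M.toEuclideanLin x, y⟫_ℂ := by
  rw [Matrix.toEuclideanLin_conjTranspose_eq_adjoint, LinearMap.adjoint_inner_right]

theorem toEuclideanLin_eq_sum_smul_col (X : Matrix (Fin n) (Fin p) ℂ)
    (x : EuclideanSpace ℂ (Fin p)) :
    X.toEuclideanLin x = ∑ j, x j • WithLp.toLp 2 (X.col j) := by
  ext i
  simp [Matrix.toLpLin_apply, Matrix.mulVec, dotProduct, mul_comm]

/-- A matrix with orthonormal columns as a linear isometry. -/
noncomputable def linearIsometryOfOrthonormalCol (X : Matrix (Fin n) (Fin p) ℂ)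
    (hX : Orthonormal ℂ fun j : Fin p => WithLp.toLp 2 (X.col j)) :
    EuclideanSpace ℂ (Fin p) →ₗᵢ[ℂ] EuclideanSpace ℂ (Fin n) :=
  X.toEuclideanLin.isometryOfInner fun x y => by
    rw [toEuclideanLin_eq_sum_smul_col, toEuclideanLin_eq_sum_smul_col, hX.inner_sum,
      PiLp.inner_apply]
    simp [mul_comm]

@[simp] theorem linearIsometryOfOrthonormalCol_apply (X : Matrix (Fin n) (Fin p) ℂ)
    (hX : Orthonormal ℂ fun j : Fin p => WithLp.toLp 2 (X.col j)) (x : EuclideanSpace ℂ (Fin p)) :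
    linearIsometryOfOrthonormalCol X hX x = X.toEuclideanLin x := rfl

theorem toEuclideanLin_residual (A : Matrix (Fin n) (Fin n) ℂ) (X : Matrix (Fin n) (Fin p) ℂ)
    (x : EuclideanSpace ℂ (Fin p)) :
    A.toEuclideanLin (X.toEuclideanLin x) =
      X.toEuclideanLin ((Xᴴ * A * X).toEuclideanLin x) + (residual A X).toEuclideanLin x := by
  simp only [residual, map_sub, LinearMap.sub_apply, toEuclideanLin_mul_apply]
  abel

theorem ColumnsFormOrthonormalBasis.range_eq {X : Matrix (Fin n) (Fin p) ℂ}
    {U : Submodule ℂ (EuclideanSpace ℂ (Fin n))} (hX : ColumnsFormOrthonormalBasis X U) :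
    LinearMap.range X.toEuclideanLin = U := by
  refine le_antisymm ?_ ?_
  · rintro _ ⟨x, rfl⟩
    rw [toEuclideanLin_eq_sum_smul_col, ← hX.2]
    exact Submodule.sum_mem _ fun j _ => Submodule.smul_mem _ _ (Submodule.subset_span ⟨j, rfl⟩)
  · rw [← hX.2, Submodule.span_le]
    rintro _ ⟨j, rfl⟩
    exact ⟨EuclideanSpace.single j 1, by
      rw [toEuclideanLin_eq_sum_smul_col, Finset.sum_eq_single j] <;> simp +contextual⟩

theorem ColumnsFormOrthonormalBasis.inner_projectorMatrix {X : Matrix (Fin n) (Fin p) ℂ}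
    {U : Submodule ℂ (EuclideanSpace ℂ (Fin n))} (hX : ColumnsFormOrthonormalBasis X U)
    (x : EuclideanSpace ℂ (Fin p)) (y : EuclideanSpace ℂ (Fin n)) :
    ⟪X.toEuclideanLin x, (projectorMatrix U).toEuclideanLin y⟫_ℂ = ⟪X.toEuclideanLin x, y⟫_ℂ := by
  have hx : X.toEuclideanLin x ∈ U := hX.range_eq ▸ LinearMap.mem_range_self _ x
  simp only [projectorMatrix, LinearEquiv.apply_symm_apply, ContinuousLinearMap.coe_coe]
  rw [← Submodule.inner_starProjection_left_eq_right, Submodule.starProjection_eq_self_iff.mpr hx]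

/-- The residual of an invariant subspace vanishes. -/
theorem ColumnsFormOrthonormalBasis.residual_eq_zero {X : Matrix (Fin n) (Fin p) ℂ}
    {U : Submodule ℂ (EuclideanSpace ℂ (Fin n))} (hX : ColumnsFormOrthonormalBasis X U)
    {A : Matrix (Fin n) (Fin n) ℂ} (hA : ∀ x ∈ U, A.toEuclideanLin x ∈ U) :
    residual A X = 0 := by
  have hXX : ∀ y, Xᴴ.toEuclideanLin (X.toEuclideanLin y) = y := fun y =>
    ext_inner_left ℂ fun z => by
      rw [inner_toEuclideanLin_conjTranspose]
      exact (linearIsometryOfOrthonormalCol X hX.1).inner_map_map z y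
  apply Matrix.toEuclideanLin.injective
  ext1 x
  have hmem : A.toEuclideanLin (X.toEuclideanLin x) ∈ LinearMap.range X.toEuclideanLin := by
    rw [hX.range_eq]
    exact hA _ (hX.range_eq ▸ LinearMap.mem_range_self _ x)
  obtain ⟨y, hy⟩ := hmem
  have h := toEuclideanLin_residual A X x
  rw [toEuclideanLin_mul_apply, toEuclideanLin_mul_apply, ← hy, hXX, left_eq_add] at h
  rw [h, map_zero, LinearMap.zero_apply]

theorem antitone_singularValueVec (M : Matrix (Fin m) (Fin p) ℂ) : Antitone (singularValueVec M) :=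
  fun _ _ hij => M.toEuclideanLin.singularValues_antitone hij

theorem singularValueVec_zero : singularValueVec (0 : Matrix (Fin m) (Fin p) ℂ) = 0 := by
  ext i
  simp [singularValueVec]

theorem maxAngle_lt_pi_div_two {X Y : Matrix (Fin n) (Fin p) ℂ} [Nonempty (Fin p)]
    (hθ : ∀ i, principalAngles X Y i < Real.pi / 2) : maxAngle X Y < Real.pi / 2 := by
  obtain ⟨i, hi⟩ := exists_eq_ciSup_of_finite (f := principalAngles X Y)
  rw [maxAngle, ← hi]
  exact hθ i

theorem maxAngle_nonneg (X Y : Matrix (Fin n) (Fin p) ℂ) : 0 ≤ maxAngle X Y :=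
  Real.iSup_nonneg fun _ => Real.arccos_nonneg _

theorem cos_maxAngle_le_singularValueVec {X Y : Matrix (Fin n) (Fin p) ℂ}
    (hθ : maxAngle X Y ≤ Real.pi) (i : Fin p) :
    Real.cos (maxAngle X Y) ≤ singularValueVec (Xᴴ * Y) i := by
  set s := singularValueVec (Xᴴ * Y) i
  have hs0 : 0 ≤ s := LinearMap.singularValues_nonneg _ _
  -- `arccos` truncates its argument, so arguments above `1` are treated separately.
  rcases le_total s 1 with hs | hs
  · have hle : Real.arccos s ≤ maxAngle X Y := by
      have h : principalAngles X Y i.rev ≤ maxAngle X Y :=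
        le_ciSup (Set.finite_range (principalAngles X Y)).bddAbove i.rev
      rwa [principalAngles, Fin.rev_rev] at h
    rw [← Real.cos_arccos (by linarith) hs]
    exact Real.cos_le_cos_of_nonneg_of_le_pi (Real.arccos_nonneg _) hθ hle
  · exact (Real.cos_le_one _).trans hs

/-- The matrix form of `mul_sum_abs_eigenvalues_sub_le`, with `γ` the cosine of the largest
principal angle. -/
theorem weaklyMajorizedBy_abs_eigenvalueVec_sub {A : Matrix (Fin n) (Fin n) ℂ}
    (hA : A.IsHermitian) {𝒳 𝒴 : Submodule ℂ (EuclideanSpace ℂ (Fin n))}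
    {X Y : Matrix (Fin n) (Fin p) ℂ} (hX : ColumnsFormOrthonormalBasis X 𝒳)
    (hY : ColumnsFormOrthonormalBasis Y 𝒴) (hθ : ∀ i, principalAngles X Y i < Real.pi / 2) :
    WeaklyMajorizedBy
      (fun i => |eigenvalueVec (Xᴴ * A * X) (Matrix.isHermitian_conjTranspose_mul_mul X hA) i -
        eigenvalueVec (Yᴴ * A * Y) (Matrix.isHermitian_conjTranspose_mul_mul Y hA) i|)
      (fun i => 1 / Real.cos (maxAngle X Y) *
        (singularValueVec (projectorMatrix 𝒴 * residual A X) i +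
          singularValueVec (projectorMatrix 𝒳 * residual A Y) i)) := by
  intro k
  have : Nonempty (Fin p) := ⟨k⟩
  have hpi := Real.pi_pos
  have hθ' := maxAngle_lt_pi_div_two hθ
  have hcos : 0 < Real.cos (maxAngle X Y) :=
    Real.cos_pos_of_mem_Ioo ⟨by linarith [maxAngle_nonneg X Y], hθ'⟩
  obtain ⟨I, -, hI, hIsum, -⟩ := exists_card_eq_sum_eq_sum_decreasing
    (fun i => |eigenvalueVec (Xᴴ * A * X) (Matrix.isHermitian_conjTranspose_mul_mul X hA) i -
        eigenvalueVec (Yᴴ * A * Y) (Matrix.isHermitian_conjTranspose_mul_mul Y hA) i|) k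
  rw [← hIsum, decreasing_eq_self, ← Finset.mul_sum, one_div, ← div_eq_inv_mul,
    le_div_iff₀' hcos]
  · have hcomp : ∀ (P : Matrix (Fin n) (Fin n) ℂ) (R : Matrix (Fin n) (Fin p) ℂ),
        P.toEuclideanLin ∘ₗ R.toEuclideanLin = (P * R).toEuclideanLin := fun P R =>
      LinearMap.ext fun x => (toEuclideanLin_mul_apply P R x).symm
    have h := mul_sum_abs_eigenvalues_sub_le (Matrix.isSymmetric_toEuclideanLin_iff.mpr hA)
      (linearIsometryOfOrthonormalCol X hX.1) (linearIsometryOfOrthonormalCol Y hY.1)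
      (Matrix.isSymmetric_toEuclideanLin_iff.mpr (Matrix.isHermitian_conjTranspose_mul_mul X hA))
      (Matrix.isSymmetric_toEuclideanLin_iff.mpr (Matrix.isHermitian_conjTranspose_mul_mul Y hA))
      (toEuclideanLin_residual A X) (toEuclideanLin_residual A Y) hX.inner_projectorMatrix
      hY.inner_projectorMatrix (C := (Xᴴ * Y).toEuclideanLin)
      (fun x y => by
        rw [toEuclideanLin_mul_apply, inner_toEuclideanLin_conjTranspose]; rfl)
      finrank_euclideanSpace_fin hcos (cos_maxAngle_le_singularValueVec (by linarith)) k I hI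
    rw [hcomp, hcomp] at h
    exact h
  · intro i j hij
    have h1 := antitone_singularValueVec (projectorMatrix 𝒴 * residual A X) hij
    have h2 := antitone_singularValueVec (projectorMatrix 𝒳 * residual A Y) hij
    exact mul_le_mul_of_nonneg_left (add_le_add h1 h2) (by positivity)

end Matrices

end RayleighRitz

theorem mainTheorem1 {n p : ℕ} (A : Matrix (Fin n) (Fin n) ℂ) (hA : A.IsHermitian)
    (𝒳 𝒴 : Submodule ℂ (EuclideanSpace ℂ (Fin n))) (X Y : Matrix (Fin n) (Fin p) ℂ)
    (hX : RayleighRitz.ColumnsFormOrthonormalBasis X 𝒳)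
    (hY : RayleighRitz.ColumnsFormOrthonormalBasis Y 𝒴)
    (hθ : ∀ i, RayleighRitz.principalAngles X Y i < Real.pi / 2) :
    RayleighRitz.WeaklyMajorizedBy
        (fun i => |RayleighRitz.eigenvalueVec (Xᴴ * A * X)
              (Matrix.isHermitian_conjTranspose_mul_mul X hA) i -
            RayleighRitz.eigenvalueVec (Yᴴ * A * Y)
              (Matrix.isHermitian_conjTranspose_mul_mul Y hA) i|)
        (fun i => 1 / Real.cos (RayleighRitz.maxAngle X Y) *
          (RayleighRitz.singularValueVec
              (RayleighRitz.projectorMatrix 𝒴 * RayleighRitz.residual A X) i +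
            RayleighRitz.singularValueVec
              (RayleighRitz.projectorMatrix 𝒳 * RayleighRitz.residual A Y) i)) ∧
      ((∀ x ∈ 𝒳, Matrix.toEuclideanLin A x ∈ 𝒳) →
        RayleighRitz.WeaklyMajorizedBy
          (fun i => |RayleighRitz.eigenvalueVec (Xᴴ * A * X)
                (Matrix.isHermitian_conjTranspose_mul_mul X hA) i -
              RayleighRitz.eigenvalueVec (Yᴴ * A * Y)
                (Matrix.isHermitian_conjTranspose_mul_mul Y hA) i|)
          (fun i => 1 / Real.cos (RayleighRitz.maxAngle X Y) *
            RayleighRitz.singularValueVec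
              (RayleighRitz.projectorMatrix 𝒳 * RayleighRitz.residual A Y) i)) := by
  have h := RayleighRitz.weaklyMajorizedBy_abs_eigenvalueVec_sub hA hX hY hθ
  refine ⟨h, fun hinv => ?_⟩
  rw [hX.residual_eq_zero hinv, Matrix.mul_zero, RayleighRitz.singularValueVec_zero] at h
  simpa only [Pi.zero_apply, zero_add] using h
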